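/- Let $\Gamma$ be a finitely presented group with a finite generating set $S$, and let $G$ be a (real, finite-dimensional) Lie group with Lie algebra $\mathfrak{g}$, equipped with any metric $d_G$ inducing its topology. Let $\operatorname{Hom}(\Gamma,G)$ be the set of group homomorphisms $\Gamma\to G$, with the uniform topology, i.e. the topology of the metric $$d_S(\varphi,\psi)=\sup_{s\in S} d_G(\varphi(s),\psi(s)).$$ For $\varphi\in\operatorname{Hom}(\Gamma,G)$ let $H^1(\Gamma,\operatorname{Ad}\circ\varphi)$ denote the first group cohomology of $\Gamma$ with coefficients in the representation $\operatorname{Ad}\circ\varphi$ of $\Gamma$ on $\mathfrak{g}$, where $\operatorname{Ad}$ is the adjoint representation of $G$. Then the set $$W=\{\varphi\in\operatorname{Hom}(\Gamma,G) : H^1(\Gamma,\operatorname{Ad}\circ\varphi)=0\}$$ is open in $\operatorname{Hom}(\Gamma,G)$. -/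

import Mathlib

open scoped Manifold ContDiff Topology

noncomputable section

namespace WeilRigidity

/-! ### The adjoint representation of a Lie group -/

section Adjoint

variable {E : Type*} [NormedAddCommGroup E] [NormedSpace ℝ E]
  {H : Type*} [TopologicalSpace H] (I : ModelWithCorners ℝ E H)
  (G : Type*) [TopologicalSpace G] [ChartedSpace H G] [Group G]

variable {G} in
/-- `Ad g`: the derivative at the identity of the conjugation `x ↦ g * x * g⁻¹`, as an endomorphism
of the Lie algebra (the tangent space at the identity). The derivative takes values in the tangent
space at `g * 1 * g⁻¹ = 1`. -/
def adMap (g : G) : GroupLieAlgebra I G →L[ℝ] GroupLieAlgebra I G :=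
  mfderiv I I (fun x : G => g * x * g⁻¹) 1

theorem mdifferentiable_conj [LieGroup I ∞ G] (g : G) :
    MDifferentiable I I (fun x : G => g * x * g⁻¹) := by
  have h : ContMDiff I I ∞ (fun x : G => g * x * g⁻¹) :=
    (contMDiff_mul_right (I := I) (n := ∞) (a := g⁻¹)).comp
      (contMDiff_mul_left (I := I) (n := ∞) (a := g))
  exact h.mdifferentiable (by simp)

theorem adMap_one [LieGroup I ∞ G] :
    adMap I (1 : G) = ContinuousLinearMap.id ℝ (GroupLieAlgebra I G) := by
  have h : (fun x : G => 1 * x * (1 : G)⁻¹) = id := by ext x; simp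
  unfold adMap
  rw [h]
  exact mfderiv_id

theorem adMap_mul [LieGroup I ∞ G] (g h : G) :
    adMap I (g * h) = (adMap I g).comp (adMap I h) := by
  have e : (fun x : G => g * h * x * (g * h)⁻¹)
      = (fun x : G => g * x * g⁻¹) ∘ (fun x : G => h * x * h⁻¹) := by
    ext x; simp [mul_assoc]
  have c := mfderiv_comp (I := I) (I' := I) (I'' := I) (1 : G)
    (mdifferentiable_conj I G g (h * 1 * h⁻¹)) (mdifferentiable_conj I G h 1)
  have p : h * 1 * h⁻¹ = (1 : G) := by simp
  unfold adMap
  rw [e]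
  refine c.trans ?_
  ext v
  change mfderiv I I (fun x : G => g * x * g⁻¹) (h * 1 * h⁻¹) _ = _
  rw [p]
  rfl

/-- The adjoint representation `Ad` of a Lie group on its Lie algebra. -/
def Ad [LieGroup I ∞ G] : Representation ℝ G (GroupLieAlgebra I G) where
  toFun g := (adMap I g : GroupLieAlgebra I G →ₗ[ℝ] GroupLieAlgebra I G)
  map_one' := by rw [adMap_one]; rfl
  map_mul' g h := by rw [adMap_mul]; rfl

end Adjoint

/-! ### First group cohomology

Mathlib's `groupCohomology` needs the group, the ring and the module to live in one universe; for
real coefficients this forces everything into `Type`. The definition below has no such restriction,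
and `subsingleton_H1_iff` checks that it agrees with Mathlib's one where both make sense. -/

section Cohomology

variable {Γ V : Type*} [Group Γ] [AddCommGroup V] [Module ℝ V]

/-- 1-cocycles: maps `b : Γ → V` with `b (γ δ) = b γ + π γ (b δ)`. -/
def Z1 (π : Representation ℝ Γ V) : Submodule ℝ (Γ → V) where
  carrier := {b | ∀ γ δ, b (γ * δ) = b γ + π γ (b δ)}
  zero_mem' := by intro γ δ; simp
  add_mem' := by
    intro a b ha hb γ δ
    simp only [Pi.add_apply, ha γ δ, hb γ δ, map_add]
    abel
  smul_mem' := by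
    intro c b hb γ δ
    simp only [Pi.smul_apply, hb γ δ, map_smul, smul_add]

/-- The differential `V → (Γ → V)`, `v ↦ (γ ↦ π γ v - v)`. -/
def d0 (π : Representation ℝ Γ V) : V →ₗ[ℝ] (Γ → V) :=
  LinearMap.pi fun γ => π γ - LinearMap.id

/-- 1-coboundaries: maps of the form `γ ↦ π γ v - v`. -/
def B1 (π : Representation ℝ Γ V) : Submodule ℝ (Γ → V) := LinearMap.range (d0 π)

/-- The first cohomology `H¹(Γ, π) = Z¹ / B¹`. -/
abbrev H1 (π : Representation ℝ Γ V) : Type _ := Z1 π ⧸ (B1 π).comap (Z1 π).subtype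

/-- The vanishing of `H1` is equivalent to the vanishing of Mathlib's first group cohomology. -/
theorem subsingleton_H1_iff {Γ V : Type} [Group Γ] [AddCommGroup V] [Module ℝ V]
    (π : Representation ℝ Γ V) :
    Subsingleton (H1 π) ↔ Subsingleton (groupCohomology (Rep.of π) 1) := by
  have hZ : ∀ b : Γ → V, b ∈ Z1 π ↔ b ∈ groupCohomology.cocycles₁ (Rep.of π) := by
    intro b
    rw [groupCohomology.mem_cocycles₁_iff]
    exact forall₂_congr fun γ δ => by rw [add_comm]
  have hB : ∀ b : Γ → V, b ∈ B1 π ↔ b ∈ groupCohomology.coboundaries₁ (Rep.of π) :=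
    fun b => Iff.rfl
  rw [Submodule.Quotient.subsingleton_iff]
  constructor
  · intro h
    refine subsingleton_of_forall_eq 0 fun x => ?_
    induction x using groupCohomology.H1_induction_on with
    | h b =>
      rw [groupCohomology.H1π_eq_zero_iff, ← hB]
      have : (⟨b.1, (hZ _).2 b.2⟩ : Z1 π) ∈ (B1 π).comap (Z1 π).subtype := by
        rw [h]; trivial
      exact this
  · intro h
    refine eq_top_iff.2 fun b _ => ?_
    have := (groupCohomology.H1π_eq_zero_iff
      (⟨b.1, (hZ _).1 b.2⟩ : groupCohomology.cocycles₁ (Rep.of π))).1 (h.elim _ _)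
    exact (hB _).2 this

end Cohomology

/-! ### The uniform metric on `Hom(Γ, G)` -/

section HomMetric

variable {Γ G : Type*} [Group Γ] [Group G] [MetricSpace G]

/-- `d_S(φ, ψ) = sup_{s ∈ S} d_G(φ s, ψ s)` for a finite set `S`. -/
def homDist (S : Finset Γ) (φ ψ : Γ →* G) : ℝ := ⨆ s : S, dist (φ s) (ψ s)

theorem dist_le_homDist (S : Finset Γ) (φ ψ : Γ →* G) (s : S) :
    dist (φ s) (ψ s) ≤ homDist S φ ψ :=
  le_ciSup (f := fun s : S => dist (φ s) (ψ s)) (Set.finite_range _).bddAbove s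

theorem homDist_nonneg (S : Finset Γ) (φ ψ : Γ →* G) : 0 ≤ homDist S φ ψ :=
  Real.iSup_nonneg fun _ => dist_nonneg

/-- The metric `d_S` on `Hom(Γ, G)`, for a finite generating set `S` of `Γ`. Its topology is the
uniform topology on `Hom(Γ, G)`. -/
abbrev homMetricSpace (S : Finset Γ) (hS : Subgroup.closure (S : Set Γ) = ⊤) :
    MetricSpace (Γ →* G) where
  dist := homDist S
  dist_self φ := by simp [homDist]
  dist_comm φ ψ := by simp [homDist, dist_comm]
  dist_triangle φ ψ χ := by
    refine Real.iSup_le (fun s => ?_)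
      (add_nonneg (homDist_nonneg S φ ψ) (homDist_nonneg S ψ χ))
    exact (dist_triangle _ (ψ s) _).trans
      (add_le_add (dist_le_homDist S φ ψ s) (dist_le_homDist S ψ χ s))
  eq_of_dist_eq_zero {φ ψ} h := by
    refine MonoidHom.eq_of_eqOn_dense hS fun s hs => ?_
    have h1 := dist_le_homDist S φ ψ ⟨s, hs⟩
    exact dist_le_zero.1 (h1.trans h.le)

/-- The uniform topology on `Hom(Γ, G)`, induced by the metric `d_S`. -/
abbrev uniformTopology (S : Finset Γ) (hS : Subgroup.closure (S : Set Γ) = ⊤) :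
    TopologicalSpace (Γ →* G) :=
  (homMetricSpace S hS).toPseudoMetricSpace.toUniformSpace.toTopologicalSpace

end HomMetric

end WeilRigidity

end

open scoped Manifold ContDiff Topology
open Filter

namespace WeilRigidity

/-! ### Continuity of the adjoint representation -/

section Adjoint

variable {E : Type*} [NormedAddCommGroup E] [NormedSpace ℝ E]
  {H : Type*} [TopologicalSpace H] (I : ModelWithCorners ℝ E H)
  {G : Type*} [TopologicalSpace G] [ChartedSpace H G]

/-! A cocycle is determined by its values on `S`, so everything can be compared inside the fixed
finite-dimensional space `S → 𝔤`: `H1` vanishes iff the restricted cocycles `Z1On` lie in the range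
of `d0On`. Suppose this holds at `φ`, and let `C` be a complement of that range. Near `φ` two
conditions persist: the range plus `C` is everything (`eventually_range_sup_eq_top`), and `Z1On`
meets `C` trivially (`eventually_disjoint_of_isClosed`), because limits of cocycles are cocycles
(`isClosed_setOf_mem_Z1On`) and the unit sphere of `C` is compact. Coboundaries being cocycles, the
`C`-component of a nearby cocycle is again a cocycle, hence zero. -/

theorem contMDiff_uncurry_conj [Group G] [LieGroup I ∞ G] :
    ContMDiff (I.prod I) I ∞ (Function.uncurry fun g x : G => g * x * g⁻¹) :=
  (contMDiff_fst.mul contMDiff_snd).mul (contMDiff_fst.inv)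

/-- Reading a family of endomorphisms of a single tangent space in tangent coordinates at its base
point changes nothing. -/
theorem inTangentCoordinates_of_eq_const [IsManifold I 1 G] {N : Type*} {a : G} {f : N → G}
    (hf : ∀ x, f x = a) (ϕ : N → E →L[ℝ] E) (x₀ x : N) :
    inTangentCoordinates I I (fun _ => a) f ϕ x₀ x = ϕ x := by
  obtain rfl : f = fun _ => a := funext hf
  have ha : a ∈ (chartAt H a).source := mem_chart_source H a
  rw [inTangentCoordinates_eq _ _ _ ha ha]
  ext v
  -- Source and target changes of coordinates both go from the chart at `a` to itself, so they fix
  -- each fibre vector.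
  have h (w : E) := (tangentBundleCore I G).coordChange_self (achart H a) a ha w
  exact (h _).trans (congrArg (ϕ x) (h v))

/-- Conjugation is jointly smooth, so its partial derivative at `1` is continuous in `g`. The type
`E →L[ℝ] E` keeps all derivatives in one normed space. -/
theorem continuous_adMap [Group G] [LieGroup I ∞ G] :
    Continuous fun g : G => (adMap I g : E →L[ℝ] E) := by
  have : IsManifold I 1 G := IsManifold.of_le (n := ∞) (by simp)
  refine continuous_iff_continuousAt.2 fun g₀ => ?_
  have h := (ContMDiffAt.mfderiv (I := I) (I' := I) (J := I) (m := 0) (x₀ := g₀)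
    (fun g x : G => g * x * g⁻¹) (fun _ => (1 : G)) (contMDiff_uncurry_conj I).contMDiffAt
    contMDiffAt_const (by simp)).continuousAt
  exact h.congr (Eventually.of_forall (inTangentCoordinates_of_eq_const I
    (f := fun g : G => g * 1 * g⁻¹) (by simp) (fun g => (adMap I g : E →L[ℝ] E)) g₀))

theorem continuous_adMap_apply [Group G] [LieGroup I ∞ G] (v : E) :
    Continuous fun g : G => (adMap I g v : E) :=
  (ContinuousLinearMap.apply ℝ E v).continuous.comp (continuous_adMap I)

end Adjoint

/-! ### Continuity of evaluation on `Hom(Γ, G)` -/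

section Evaluation

variable {Γ G : Type*} [Group Γ] [Group G] [MetricSpace G] [IsTopologicalGroup G]

/-- Evaluations at generators are 1-Lipschitz, and the elements with continuous evaluation form a
subgroup. -/
theorem continuous_eval (S : Finset Γ) (hS : Subgroup.closure (S : Set Γ) = ⊤) (γ : Γ) :
    @Continuous _ _ (uniformTopology S hS) _ fun φ : Γ →* G => φ γ := by
  let _ := homMetricSpace (G := G) S hS
  have hγ : γ ∈ Subgroup.closure (S : Set Γ) := hS ▸ Subgroup.mem_top γ
  induction hγ using Subgroup.closure_induction with
  | mem s hs =>
    exact (LipschitzWith.mk_one (f := fun φ : Γ →* G => φ s)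
      fun φ ψ => dist_le_homDist S φ ψ ⟨s, hs⟩).continuous
  | one => simpa using continuous_const
  | mul _ _ _ _ h₁ h₂ => simpa only [map_mul] using! h₁.mul h₂
  | inv _ _ h => simpa only [map_inv] using! h.inv

end Evaluation

/-! ### Openness of the vanishing of `H1` in a continuous family of representations -/

section Family

variable {Γ V : Type*} [Group Γ]

section Algebra

variable [AddCommGroup V] [Module ℝ V] (π : Representation ℝ Γ V)

theorem subsingleton_H1_iff_Z1_le : Subsingleton (H1 π) ↔ Z1 π ≤ B1 π := by
  rw [Submodule.Quotient.subsingleton_iff, Submodule.comap_subtype_eq_top]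

theorem B1_le_Z1 : B1 π ≤ Z1 π := by
  rintro _ ⟨v, rfl⟩ γ δ
  simp [d0]

variable {π} in
theorem map_one_of_mem_Z1 {b : Γ → V} (hb : b ∈ Z1 π) : b 1 = 0 := by
  simpa using hb 1 1

variable {π} in
theorem map_inv_of_mem_Z1 {b : Γ → V} (hb : b ∈ Z1 π) (γ : Γ) : b γ⁻¹ = -π γ⁻¹ (b γ) := by
  have h := hb γ⁻¹ γ
  rw [inv_mul_cancel, map_one_of_mem_Z1 hb] at h
  exact eq_neg_of_add_eq_zero_left h.symm

variable {π} in
/-- Cocycles are determined by their values on a generating set. -/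
theorem Z1_ext {S : Set Γ} (hS : Subgroup.closure S = ⊤) {b c : Γ → V} (hb : b ∈ Z1 π)
    (hc : c ∈ Z1 π) (h : ∀ s : S, b s = c s) : b = c := by
  ext γ
  have hγ : γ ∈ Subgroup.closure S := hS ▸ Subgroup.mem_top γ
  induction hγ using Subgroup.closure_induction with
  | mem s hs => exact h ⟨s, hs⟩
  | one => rw [map_one_of_mem_Z1 hb, map_one_of_mem_Z1 hc]
  | mul γ δ _ _ h₁ h₂ => rw [hb, hc, h₁, h₂]
  | inv γ _ h => rw [map_inv_of_mem_Z1 hb, map_inv_of_mem_Z1 hc, h]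

/-- The restrictions of cocycles to a subset. -/
def Z1On (S : Set Γ) : Submodule ℝ (S → V) :=
  (Z1 π).map (LinearMap.funLeft ℝ V ((↑) : S → Γ))

/-- The differential `V → (Γ → V)` followed by restriction to a subset. -/
def d0On (S : Set Γ) : V →ₗ[ℝ] (S → V) :=
  LinearMap.funLeft ℝ V ((↑) : S → Γ) ∘ₗ d0 π

theorem range_d0On_le_Z1On (S : Set Γ) : LinearMap.range (d0On π S) ≤ Z1On π S := by
  rintro _ ⟨v, rfl⟩
  exact ⟨d0 π v, B1_le_Z1 π ⟨v, rfl⟩, rfl⟩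

/-- For a generating set, `H1` vanishes iff `V → (S → V)` hits all restrictions of cocycles. -/
theorem subsingleton_H1_iff_Z1On_le {S : Set Γ} (hS : Subgroup.closure S = ⊤) :
    Subsingleton (H1 π) ↔ Z1On π S ≤ LinearMap.range (d0On π S) := by
  rw [subsingleton_H1_iff_Z1_le]
  constructor
  · rintro h _ ⟨b, hb, rfl⟩
    obtain ⟨v, rfl⟩ := h hb
    exact ⟨v, rfl⟩
  · intro h b hb
    obtain ⟨v, hv⟩ := h ⟨b, hb, rfl⟩
    exact ⟨v, Z1_ext hS (B1_le_Z1 π ⟨v, rfl⟩) hb fun s => congrFun hv s⟩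

end Algebra

variable [NormedAddCommGroup V] [NormedSpace ℝ V]
  {X : Type*} [TopologicalSpace X] {π : X → Representation ℝ Γ V}

/-- In a family of representations that is continuous in the parameter, the action is jointly
continuous. -/
theorem tendsto_rep_apply [FiniteDimensional ℝ V]
    (hπ : ∀ γ v, Continuous fun x => π x γ v) {ι : Type*} {l : Filter ι}
    {p : ι → X} {x : X} (hp : Tendsto p l (𝓝 x)) {u : ι → V} {v : V} (hu : Tendsto u l (𝓝 v))
    (γ : Γ) : Tendsto (fun i => π (p i) γ (u i)) l (𝓝 (π x γ v)) := by
  have h : Continuous fun x => LinearMap.toContinuousLinearMap (π x γ) :=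
    continuous_clm_apply.2 fun v => hπ γ v
  exact (isBoundedBilinearMap_apply.continuous.tendsto
    (LinearMap.toContinuousLinearMap (π x γ), v)).comp (((h.tendsto x).comp hp).prodMk_nhds hu)

/-- The graph of `x ↦ Z1On (π x) S` is closed. -/
theorem isClosed_setOf_mem_Z1On [FiniteDimensional ℝ V]
    (hπ : ∀ γ v, Continuous fun x => π x γ v) {S : Set Γ}
    (hS : Subgroup.closure S = ⊤) : IsClosed {p : X × (S → V) | p.2 ∈ Z1On (π p.1) S} := by
  refine isClosed_of_closure_subset fun ⟨x, f⟩ hxf => ?_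
  set A := {p : X × (S → V) | p.2 ∈ Z1On (π p.1) S}
  have : (𝓝[A] (x, f)).NeBot := mem_closure_iff_nhdsWithin_neBot.1 hxf
  have hex : ∀ p : X × (S → V), ∃ b : Γ → V, p ∈ A → b ∈ Z1 (π p.1) ∧ ∀ s : S, b s = p.2 s := by
    intro p
    by_cases hp : p ∈ A
    · obtain ⟨b, hb, h⟩ := hp
      exact ⟨b, fun _ => ⟨hb, fun s => congrFun h s⟩⟩
    · exact ⟨0, fun h => absurd h hp⟩
  choose B hB using hex
  have hA : ∀ᶠ p in 𝓝[A] (x, f), p ∈ A := eventually_mem_nhdsWithin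
  have hfst : Tendsto (fun p : X × (S → V) => p.1) (𝓝[A] (x, f)) (𝓝 x) :=
    (continuous_fst.tendsto (x, f)).mono_left nhdsWithin_le_nhds
  have hsnd (s : S) : Tendsto (fun p : X × (S → V) => p.2 s) (𝓝[A] (x, f)) (𝓝 (f s)) :=
    (((continuous_apply s).comp continuous_snd).tendsto (x, f)).mono_left nhdsWithin_le_nhds
  have hmem (s : S) : Tendsto (fun p => B p s) (𝓝[A] (x, f)) (𝓝 (f s)) :=
    (hsnd s).congr' (hA.mono fun p hp => ((hB p hp).2 s).symm)
  -- Only convergence on `S` is given; the cocycle identity and the joint continuity of the action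
  -- propagate it to all of `Γ`.
  have hlim : ∀ γ : Γ, ∃ v, Tendsto (fun p => B p γ) (𝓝[A] (x, f)) (𝓝 v) := by
    intro γ
    have hγ : γ ∈ Subgroup.closure S := hS ▸ Subgroup.mem_top γ
    induction hγ using Subgroup.closure_induction with
    | mem s hs => exact ⟨_, hmem ⟨s, hs⟩⟩
    | one =>
      exact ⟨0, tendsto_const_nhds.congr'
        (hA.mono fun p hp => (map_one_of_mem_Z1 (hB p hp).1).symm)⟩
    | mul γ δ _ _ h₁ h₂ =>
      obtain ⟨v, hv⟩ := h₁
      obtain ⟨w, hw⟩ := h₂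
      exact ⟨_, (hv.add (tendsto_rep_apply hπ hfst hw γ)).congr'
        (hA.mono fun p hp => ((hB p hp).1 γ δ).symm)⟩
    | inv γ _ h =>
      obtain ⟨v, hv⟩ := h
      exact ⟨_, (tendsto_rep_apply hπ hfst hv γ⁻¹).neg.congr'
        (hA.mono fun p hp => (map_inv_of_mem_Z1 (hB p hp).1 γ).symm)⟩
  choose b hb using hlim
  refine ⟨b, fun γ δ => ?_, funext fun s => tendsto_nhds_unique (hb s) (hmem s)⟩
  exact tendsto_nhds_unique (hb (γ * δ)) (((hb γ).add (tendsto_rep_apply hπ hfst (hb δ) γ)).congr'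
    (hA.mono fun p hp => ((hB p hp).1 γ δ).symm))

/-- A subspace meeting a closed family of subspaces trivially at one parameter does so at all nearby
parameters. -/
theorem eventually_disjoint_of_isClosed {F : Type*} [NormedAddCommGroup F] [NormedSpace ℝ F]
    [FiniteDimensional ℝ F] {K : X → Submodule ℝ F}
    (hK : IsClosed {p : X × F | p.2 ∈ K p.1}) (C : Submodule ℝ F) {x : X}
    (hx : Disjoint (K x) C) : ∀ᶠ y in 𝓝 x, Disjoint (K y) C := by
  have : CompactSpace (Metric.sphere (0 : C) 1) :=
    isCompact_iff_compactSpace.1 (isCompact_sphere _ _)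
  have hT : IsClosed {p : X × Metric.sphere (0 : C) 1 | ((p.2 : C) : F) ∈ K p.1} :=
    hK.preimage (f := fun p : X × Metric.sphere (0 : C) 1 => (p.1, ((p.2 : C) : F))) (by fun_prop)
  -- The bad parameters are the projection of a closed set along a compact factor, hence closed.
  have hU := (isClosedMap_fst_of_compactSpace _ hT).isOpen_compl.mem_nhds (x := x) (by
    rintro ⟨⟨_, c⟩, hc, rfl⟩
    have h0 : ((c : C) : F) = 0 := Submodule.disjoint_def.1 hx _ hc c.1.2
    have h1 : ‖(c : C)‖ = 1 := by simp
    rw [Submodule.coe_eq_zero] at h0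
    simp [h0] at h1)
  filter_upwards [hU] with y hy
  refine Submodule.disjoint_def.2 fun c hcK hcC => by_contra fun hc => hy ?_
  have hn : ‖(⟨c, hcC⟩ : C)‖ ≠ 0 := by simpa using hc
  refine ⟨(y, ⟨‖(⟨c, hcC⟩ : C)‖⁻¹ • ⟨c, hcC⟩, ?_⟩), ?_, rfl⟩
  · rw [mem_sphere_zero_iff_norm, norm_smul, norm_inv, norm_norm, inv_mul_cancel₀ hn]
  · exact (K y).smul_mem _ hcK

/-- In a continuous family of linear maps, surjectivity modulo a fixed subspace is an open
condition. -/
theorem eventually_range_sup_eq_top {F : Type*} [NormedAddCommGroup F] [NormedSpace ℝ F]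
    [FiniteDimensional ℝ F] {A : X → V →ₗ[ℝ] F} (hA : ∀ v, Continuous fun x => A x v)
    (C : Submodule ℝ F) {x : X} (hx : LinearMap.range (A x) ⊔ C = ⊤) :
    ∀ᶠ y in 𝓝 x, LinearMap.range (A y) ⊔ C = ⊤ := by
  let T (y : X) : V × C →ₗ[ℝ] F := (A y).coprod C.subtype
  have hr (y : X) : LinearMap.range (T y) = LinearMap.range (A y) ⊔ C := by
    simp [T, LinearMap.range_coprod]
  -- With `R` fixed, `T y ∘ₗ R` is the identity at `y = x`, so it stays invertible nearby, which
  -- forces `T y` to be onto.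
  obtain ⟨R, hR⟩ := (T x).exists_rightInverse_of_surjective ((hr x).trans hx)
  let Q (y : X) : F →L[ℝ] F := LinearMap.toContinuousLinearMap (T y ∘ₗ R)
  have hQ : Continuous Q := continuous_clm_apply.2 fun f => by
    have : Continuous fun y => A y (R f).1 + ((R f).2 : F) := (hA _).add continuous_const
    exact this
  have hQx : IsUnit (Q x) := by
    have : Q x = 1 := by
      ext f
      exact LinearMap.congr_fun hR f
    rw [this]
    exact isUnit_one
  filter_upwards [hQ.continuousAt.eventually_mem (Units.isOpen.mem_nhds hQx)] with y hy
  rw [← hr, LinearMap.range_eq_top]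
  intro f
  obtain ⟨u, hu⟩ := hy
  refine ⟨R ((↑u⁻¹ : F →L[ℝ] F) f), ?_⟩
  have : (Q y * (↑u⁻¹ : F →L[ℝ] F)) f = f := by rw [← hu, Units.mul_inv]; rfl
  exact this

/-- The vanishing of `H1` is an open condition in a continuous family of finite-dimensional
representations of a finitely generated group. -/
theorem isOpen_setOf_subsingleton_H1 [FiniteDimensional ℝ V]
    (hπ : ∀ γ v, Continuous fun x => π x γ v) {S : Set Γ}
    [Finite S] (hS : Subgroup.closure S = ⊤) : IsOpen {x | Subsingleton (H1 (π x))} := by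
  have := Fintype.ofFinite S
  simp only [subsingleton_H1_iff_Z1On_le _ hS]
  refine isOpen_iff_mem_nhds.2 fun x (hZ : Z1On (π x) S ≤ LinearMap.range (d0On (π x) S)) => ?_
  obtain ⟨C, hC⟩ := (LinearMap.range (d0On (π x) S)).exists_isCompl
  have hA (v : V) : Continuous fun y => d0On (π y) S v :=
    continuous_pi fun s => (hπ s v).sub continuous_const
  filter_upwards [eventually_disjoint_of_isClosed (K := fun y => Z1On (π y) S)
    (isClosed_setOf_mem_Z1On hπ hS) C (hC.disjoint.mono_left hZ),
    eventually_range_sup_eq_top hA C hC.sup_eq_top] with y hd ht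
  intro f hf
  obtain ⟨a, ha, c, hc, rfl⟩ := Submodule.mem_sup.1 (ht ▸ Submodule.mem_top (x := f))
  have h := (Submodule.add_mem_iff_right _ (range_d0On_le_Z1On _ S ha)).1 hf
  rwa [Submodule.disjoint_def.1 hd c h hc, add_zero]

end Family

end WeilRigidity

/-- Let `Γ` be a finitely presented group with a finite generating set `S`, and let `G` be a real
finite-dimensional Lie group, with any metric that induces its topology. Then the set of
homomorphisms `φ : Γ → G` with `H¹(Γ, Ad ∘ φ) = 0` is open in `Hom(Γ, G)` for the topology of the
metric `d_S(φ, ψ) = sup_{s ∈ S} d_G(φ s, ψ s)`. -/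
theorem mainTheorem10
    {Γ : Type*} [Group Γ] [Group.IsFinitelyPresented Γ]
    (S : Finset Γ) (hS : Subgroup.closure (S : Set Γ) = ⊤)
    {E : Type*} [NormedAddCommGroup E] [NormedSpace ℝ E] [FiniteDimensional ℝ E]
    {H : Type*} [TopologicalSpace H] (I : ModelWithCorners ℝ E H) [I.Boundaryless]
    {G : Type*} [MetricSpace G] [ChartedSpace H G] [Group G] [LieGroup I ∞ G] :
    IsOpen[WeilRigidity.uniformTopology S hS]
      {φ : Γ →* G | Subsingleton (WeilRigidity.H1 ((WeilRigidity.Ad I G).comp φ))} := by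
  let _ := WeilRigidity.uniformTopology (G := G) S hS
  have : IsTopologicalGroup G := topologicalGroup_of_lieGroup I ∞
  have : Finite (S : Set Γ) := S.finite_toSet
  -- The Lie algebra unfolds to `E`, whose norm and finite dimension are used next.
  let π (φ : Γ →* G) : Representation ℝ Γ E := (WeilRigidity.Ad I G).comp φ
  have hπ (γ : Γ) (v : E) : Continuous fun φ => π φ γ v :=
    (WeilRigidity.continuous_adMap_apply I v).comp (WeilRigidity.continuous_eval S hS γ)
  exact WeilRigidity.isOpen_setOf_subsingleton_H1 (V := E) (π := π) hπ hS
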